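/- Let $a>0$ and $c\in\mathbb R$, and put $\mathbb H_a=\{(r,\theta): r>0,\ |\theta|<a\}$. A function $f:\mathbb H_a\to\mathbb C$ is called polar-analytic if for every $(r_0,\theta_0)\in\mathbb H_a$ the limit $$\lim_{(r,\theta)\to(r_0,\theta_0)}\frac{f(r,\theta)-f(r_0,\theta_0)}{re^{i\theta}-r_0e^{i\theta_0}}$$ exists. Let $X^2_c$ be the space of measurable $\varphi:(0,\infty)\to\mathbb C$ with $\|\varphi\|_{X^2_c}=\big(\int_0^\infty|\varphi(r)|^2r^{2c-1}\,dr\big)^{1/2}<\infty$, and let $X^\infty_c$ be the space of measurable $h:(0,\infty)\to\mathbb C$ with $\|h\|_{X^\infty_c}=\sup_{x>0}x^c|h(x)|<\infty$. Let the Mellin–Hardy space $H^2_c(\mathbb H_a)$ consist of all polar-analytic $f:\mathbb H_a\to\mathbb C$ such that $f(\cdot,\theta)\in X^2_c$ for every $\theta\in(-a,a)$ and $$\sup_{0<\theta<a}\Big(\tfrac12\big(\|f(\cdot,\theta)\|_{X^2_c}^2+\|f(\cdot,-\theta)\|_{X^2_c}^2\big)\Big)^{1/2}<\infty.$$ For $b\in\mathbb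 R$ let $\mathrm{lin}_b(x)=x^{-b}\,\mathrm{sinc}(\log x)$ for $x>0$, where $\mathrm{sinc}(t)=\frac{\sin\pi t}{\pi t}$ for $t\ne0$ and $\mathrm{sinc}(0)=1$. Let $f\in H^2_c(\mathbb H_a)$ and $g(x)=f(x,0)$ for $x>0$. Then for all $T>0$ and $x>0$ the exponential sampling series of $g$ converges absolutely, so that the remainder $$(R_{\pi T}g)(x)=g(x)-\sum_{k\in\mathbb Z}g(e^{k/T})\,\mathrm{lin}_{c/T}(e^{-k}x^T)$$ is well defined; moreover $R_{\pi T}g\in X^\infty_c$ for all $T>0$, and $$\|R_{\pi T}g\|_{X^\infty_c}=\mathcal O(e^{-a\pi T})\qquad(T\to+\infty).$$ -/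

import Mathlib

open Real Set Filter Topology MeasureTheory Asymptotics
open scoped ENNReal

noncomputable section

namespace MellinHardy

/-! Functions on the half-line `(0, ∞)` and on subsets of the polar half-plane are represented by
functions on `ℝ` and on `ℝ × ℝ`; every notion below depends only on the values on `(0, ∞)`,
respectively on the domain. -/

/-- The weighted function `r ↦ r ^ (c - 1 / p) φ(r)`. -/
def weighted (p c : ℝ) (φ : ℝ → ℂ) : ℝ → ℂ := fun r => (r ^ (c - 1 / p) : ℝ) • φ r

/-- `φ ∈ X^p_c` for a real exponent `p ≥ 1`: the function `r ^ (c - 1 / p) φ(r)` lies in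
`L^p(0, ∞)`. -/
def MemX (p c : ℝ) (φ : ℝ → ℂ) : Prop :=
  MemLp (weighted p c φ) (ENNReal.ofReal p) (volume.restrict (Ioi 0))

/-- The norm of `X^p_c`, with value `∞` allowed:
`(∫_0^∞ |φ(r)| ^ p r ^ (c p - 1) dr) ^ (1 / p)`. -/
def xNorm (p c : ℝ) (φ : ℝ → ℂ) : ℝ≥0∞ :=
  eLpNorm (weighted p c φ) (ENNReal.ofReal p) (volume.restrict (Ioi 0))

/-- `h ∈ X^∞_c`: `h` is Lebesgue measurable on `(0, ∞)` and `sup_{x > 0} x ^ c |h(x)|` is finite. -/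
def MemXInf (c : ℝ) (h : ℝ → ℂ) : Prop :=
  AEStronglyMeasurable h (volume.restrict (Ioi 0)) ∧
    BddAbove ((fun x : ℝ => x ^ c * ‖h x‖) '' Ioi 0)

/-- The norm `sup_{x > 0} x ^ c |h(x)|` of `X^∞_c` (meaningful for members of that space). -/
def xInfNorm (c : ℝ) (h : ℝ → ℂ) : ℝ :=
  sSup ((fun x : ℝ => x ^ c * ‖h x‖) '' Ioi 0)

/-- The complex number `r e^{iθ}` with polar coordinates `(r, θ)`. -/
def polarPoint (q : ℝ × ℝ) : ℂ := (q.1 : ℂ) * Complex.exp ((q.2 : ℂ) * Complex.I)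

/-- Polar-analyticity on a set `D` of pairs `(r, θ)`: at every point of `D` the difference quotient
of `f` with respect to `r e^{iθ}` has a limit within `D`. -/
def PolarAnalyticOn (f : ℝ × ℝ → ℂ) (D : Set (ℝ × ℝ)) : Prop :=
  ∀ q₀ ∈ D, ∃ L : ℂ,
    Tendsto (fun q => (f q - f q₀) / (polarPoint q - polarPoint q₀)) (𝓝[D \ {q₀}] q₀) (𝓝 L)

/-- The strip of all `(r, θ)` with `r > 0` and `-a < θ < a`. -/
def strip (a : ℝ) : Set (ℝ × ℝ) := Ioi 0 ×ˢ Ioo (-a) a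

/-- The Mellin–Hardy norm on the strip of half-width `a`, with value `∞` allowed. -/
def hardyNorm (p c a : ℝ) (f : ℝ × ℝ → ℂ) : ℝ≥0∞ :=
  ⨆ θ ∈ Ioo 0 a,
    ((xNorm p c (fun r => f (r, θ)) ^ p + xNorm p c (fun r => f (r, -θ)) ^ p) / 2) ^ (1 / p)

/-- Membership in the Mellin–Hardy space `H^p_c` of the strip of half-width `a`. -/
structure MemHardy (p c a : ℝ) (f : ℝ × ℝ → ℂ) : Prop where
  polarAnalytic : PolarAnalyticOn f (strip a)
  memX : ∀ θ ∈ Ioo (-a) a, MemX p c (fun r => f (r, θ))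
  norm_lt_top : hardyNorm p c a f < ∞

/-- `lin_c(x) = x ^ (-c) sinc(log x)` with `sinc t = sin (π t) / (π t)`, `sinc 0 = 1`
(Mathlib's `Real.sinc` is the unnormalised `sin t / t`). -/
def lin (c x : ℝ) : ℝ := x ^ (-c) * Real.sinc (π * Real.log x)

/-- The `k`-th term of the exponential sampling series of `g` with rate `T`:
`g(e^{k/T}) lin_{c/T}(e^{-k} x^T)`. -/
def samplingTerm (c T : ℝ) (g : ℝ → ℂ) (x : ℝ) (k : ℤ) : ℂ :=
  g (Real.exp (k / T)) * (lin (c / T) (Real.exp (-k) * x ^ T) : ℂ)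

/-- The remainder `R_{πT} g` of the exponential sampling formula. -/
def remainder (c T : ℝ) (g : ℝ → ℂ) (x : ℝ) : ℂ :=
  g x - ∑' k : ℤ, samplingTerm c T g x k

end MellinHardy

end

/-! The substitution z ↦ e^{z/T} turns the problem into classical Shannon sampling. The function
F(z) = f(e^{Re z/T}, Im z/T) e^{cz/T} (`logLift`) is holomorphic on |Im z| < aT, its squared L²
norms on horizontal lines are at most TM with M independent of T, and x^c times the exponential
sampling series at x is the cardinal series of F at t = T log x (`samplingTerm_eq`).

For such an F the error of the truncated cardinal series is sin(πt)/(2πi) times the integral of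
F(z)/(sin(πz)(z - t)) around the rectangle with abscissae ±(N + 1/2) and ordinates ±θ
(`rectIntegral_sampling`). As N → ∞ the vertical sides vanish, because F is bounded on smaller
strips (`exists_norm_le_of_lintegral_le`). On the horizontal sides |sin(πz)| ≥ sinh(πθ), which is
the source of the exponential decay, and Cauchy–Schwarz in the form of a weighted AM-GM inequality
handles F(z)/(z - t) (`norm_integral_horizontal_le`). Letting θ → aT and choosing the AM-GM weight
1/T gives the bound (M + π/a)/(2 sinh(aπT)), uniform in x. -/

namespace MellinHardy

/-! ### Mean value estimates for square-integrable holomorphic functions on a strip -/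

/-- The open horizontal strip of half-width `α` in the complex plane. -/
def horizontalStrip (α : ℝ) : Set ℂ := {z | |z.im| < α}

theorem isOpen_horizontalStrip (α : ℝ) : IsOpen (horizontalStrip α) :=
  isOpen_lt (continuous_abs.comp Complex.continuous_im) continuous_const

theorem ball_subset_horizontalStrip {α δ : ℝ} {z : ℂ} (h : |z.im| + δ ≤ α) :
    Metric.ball z δ ⊆ horizontalStrip α := by
  intro w hw
  have h1 : |(w - z).im| < δ := (Complex.abs_im_le_norm _).trans_lt (by simpa [dist_eq_norm] using hw)
  have h2 : |w.im| ≤ |(w - z).im| + |z.im| := by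
    have := abs_add_le (w - z).im z.im
    simpa using this
  show |w.im| < α
  linarith

/-- Cauchy's mean value formula followed by the triangle inequality. The angle runs over (-π, π) to
match the range of polar coordinates. -/
theorem enorm_le_lintegral_circle {G : ℂ → ℂ} {z : ℂ} {δ ρ : ℝ}
    (hG : DifferentiableOn ℂ G (Metric.ball z δ)) (h0 : 0 < ρ) (hρ : ρ < δ) :
    ENNReal.ofReal (2 * π) * ‖G z‖ₑ ≤ ∫⁻ φ in Ioo (-π) π, ‖G (circleMap z ρ φ)‖ₑ := by
  have hd : DiffContOnCl ℂ G (Metric.ball z |ρ|) := by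
    apply DifferentiableOn.diffContOnCl
    apply hG.mono
    rw [abs_of_pos h0]
    exact Metric.closure_ball_subset_closedBall.trans (Metric.closedBall_subset_ball hρ)
  have h1 := hd.circleAverage
  rw [circleAverage_eq_integral_add (-π),
    intervalIntegral.integral_comp_add_right (fun θ => G (circleMap z ρ θ)),
    intervalIntegral.integral_of_le (by linarith [pi_pos]), show 0 + -π = -π by ring,
    show 2 * π + -π = π by ring] at h1
  have h2 : ((2 * π : ℝ) : ℂ) * G z = ∫ θ in Ioc (-π) π, G (circleMap z ρ θ) := by
    rw [← h1, Complex.real_smul, ← mul_assoc, ← Complex.ofReal_mul,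
      mul_inv_cancel₀ (by positivity), Complex.ofReal_one, one_mul]
  calc ENNReal.ofReal (2 * π) * ‖G z‖ₑ = ‖((2 * π : ℝ) : ℂ) * G z‖ₑ := by
        rw [enorm_mul, ← ofReal_norm ((2 * π : ℝ) : ℂ), Complex.norm_real,
          Real.norm_of_nonneg (by positivity)]
    _ ≤ ∫⁻ φ in Ioc (-π) π, ‖G (circleMap z ρ φ)‖ₑ := by
        rw [h2]; exact enorm_integral_le_lintegral_enorm _
    _ = _ := by rw [restrict_Ioo_eq_restrict_Ioc]

theorem lintegral_Ioo_ofReal {δ : ℝ} (hδ : 0 < δ) :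
    ∫⁻ ρ in Ioo 0 δ, ENNReal.ofReal ρ = ENNReal.ofReal (δ ^ 2 / 2) := by
  rw [← ofReal_integral_eq_lintegral_ofReal]
  · rw [← integral_Ioc_eq_integral_Ioo, ← intervalIntegral.integral_of_le hδ.le, integral_id]
    simp
  · exact (continuous_id.integrableOn_Icc (a := 0) (b := δ)).mono_set Ioo_subset_Icc_self
  · filter_upwards [ae_restrict_mem measurableSet_Ioo] with x hx using hx.1.le

/-- The mean value inequality on a disc. -/
theorem enorm_le_lintegral_ball {G : ℂ → ℂ} {z : ℂ} {δ : ℝ} (hδ : 0 < δ)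
    (hG : DifferentiableOn ℂ G (Metric.ball z δ)) :
    ENNReal.ofReal (π * δ ^ 2) * ‖G z‖ₑ ≤ ∫⁻ w in Metric.ball z δ, ‖G w‖ₑ := by
  classical
  -- Extension by zero gives a globally measurable function, so that polar coordinates and Tonelli
  -- apply.
  set H : ℂ → ℂ := (Metric.ball z δ).piecewise G 0 with hH
  have hHm : Measurable H :=
    ContinuousOn.measurable_piecewise hG.continuousOn continuousOn_const
      Metric.isOpen_ball.measurableSet
  have e1 : ∫⁻ w in Metric.ball z δ, ‖G w‖ₑ = ∫⁻ w, ‖H (z + w)‖ₑ := by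
    rw [lintegral_add_left_eq_self (fun w => ‖H w‖ₑ) z,
      ← lintegral_indicator Metric.isOpen_ball.measurableSet]
    congr 1 with w
    by_cases hw : w ∈ Metric.ball z δ <;> simp [hH, hw]
  rw [e1, ← Complex.lintegral_comp_polarCoord_symm, polarCoord_target, Measure.volume_eq_prod,
    setLIntegral_prod]
  · calc ENNReal.ofReal (π * δ ^ 2) * ‖G z‖ₑ
        = ∫⁻ ρ in Ioo 0 δ, ENNReal.ofReal ρ * (ENNReal.ofReal (2 * π) * ‖G z‖ₑ) := by
          rw [lintegral_mul_const _ ENNReal.measurable_ofReal, lintegral_Ioo_ofReal hδ, ← mul_assoc,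
            ← ENNReal.ofReal_mul (by positivity)]
          congr 2; ring
      _ ≤ ∫⁻ ρ in Ioo 0 δ, ∫⁻ φ in Ioo (-π) π,
            ENNReal.ofReal ρ • ‖H (z + Complex.polarCoord.symm (ρ, φ))‖ₑ := by
          apply setLIntegral_mono' measurableSet_Ioo
          intro ρ hρ
          have e2 : ∀ φ : ℝ, H (z + Complex.polarCoord.symm (ρ, φ)) = G (circleMap z ρ φ) := by
            intro φ
            have : z + Complex.polarCoord.symm (ρ, φ) = circleMap z ρ φ := by
              rw [Complex.polarCoord_symm_apply, circleMap, Complex.exp_mul_I]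
              simp
            rw [this, hH, Set.piecewise_eq_of_mem]
            simpa [dist_eq_norm, abs_of_pos hρ.1] using hρ.2
          simp only [e2, smul_eq_mul]
          rw [lintegral_const_mul' _ _ ENNReal.ofReal_ne_top]
          gcongr
          exact enorm_le_lintegral_circle hG hρ.1 hρ.2
      _ ≤ _ := lintegral_mono_set Ioo_subset_Ioi_self
  · apply Measurable.aemeasurable
    have m1 : Measurable fun p : ℝ × ℝ => ENNReal.ofReal p.1 :=
      ENNReal.measurable_ofReal.comp measurable_fst
    have m2 : Measurable fun p : ℝ × ℝ => ‖H (z + Complex.polarCoord.symm p)‖ₑ := by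
      apply Measurable.enorm
      apply hHm.comp
      apply Measurable.const_add
      rw [show ⇑Complex.polarCoord.symm = _ from funext Complex.polarCoord_symm_apply]
      fun_prop
    exact m1.mul m2

variable {F : ℂ → ℂ} {α L : ℝ}

/-- The area integral of `‖F‖²` over a strip is controlled by the integrals along lines. -/
theorem lintegral_horizontalStrip_le
    (hL : ∀ y : ℝ, |y| < α → ∫⁻ s : ℝ, ‖F (s + y * Complex.I)‖ₑ ^ 2 ≤ ENNReal.ofReal L)
    (hF : DifferentiableOn ℂ F (horizontalStrip α)) :
    ∫⁻ w in horizontalStrip α, ‖F w‖ₑ ^ 2 ≤ ENNReal.ofReal L * ENNReal.ofReal (2 * α) := by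
  classical
  set H : ℂ → ℂ := (horizontalStrip α).piecewise F 0 with hH
  have hHm : Measurable H :=
    ContinuousOn.measurable_piecewise hF.continuousOn continuousOn_const
      (isOpen_horizontalStrip α).measurableSet
  have e1 : ∫⁻ w in horizontalStrip α, ‖F w‖ₑ ^ 2 = ∫⁻ w, ‖H w‖ₑ ^ 2 := by
    rw [← lintegral_indicator (isOpen_horizontalStrip α).measurableSet]
    congr 1 with w
    by_cases hw : w ∈ horizontalStrip α <;> simp [hH, hw]
  rw [e1, ← (Complex.volume_preserving_equiv_real_prod.symm).lintegral_comp_emb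
    Complex.measurableEquivRealProd.symm.measurableEmbedding, Measure.volume_eq_prod,
    lintegral_prod_symm]
  · calc _ ≤ ∫⁻ y : ℝ, (Ioo (-α) α).indicator (fun _ => ENNReal.ofReal L) y := by
          apply lintegral_mono
          intro y
          have e2 : ∀ s : ℝ, Complex.measurableEquivRealProd.symm (s, y) = s + y * Complex.I := by
            intro s
            exact Complex.mk_eq_add_mul_I s y
          simp only [e2]
          by_cases hy : |y| < α
          · rw [indicator_of_mem (by exact abs_lt.1 hy)]
            refine le_trans (le_of_eq ?_) (hL y hy)
            congr 1 with s
            rw [hH, Set.piecewise_eq_of_mem]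
            simpa [horizontalStrip] using hy
          · rw [indicator_of_notMem (by rw [mem_Ioo, ← abs_lt]; exact hy)]
            simp only [nonpos_iff_eq_zero]
            rw [lintegral_eq_zero_iff']
            · refine Eventually.of_forall fun s => ?_
              have : H (s + y * Complex.I) = 0 := by
                rw [hH, Set.piecewise_eq_of_notMem]
                · rfl
                · simpa [horizontalStrip] using hy
              simp [this]
            · refine Measurable.aemeasurable ?_
              exact (hHm.comp (by fun_prop)).enorm.pow_const 2
      _ = _ := by
          rw [lintegral_indicator measurableSet_Ioo, setLIntegral_const, Real.volume_Ioo]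
          congr 2; ring
  · apply Measurable.aemeasurable
    exact (hHm.comp (MeasurableEquiv.measurable _)).enorm.pow_const 2

/-- F² is holomorphic too, so the mean value inequality applies to it. -/
theorem enorm_sq_le_lintegral_ball {z : ℂ} {δ : ℝ} (hδ : 0 < δ)
    (hF : DifferentiableOn ℂ F (Metric.ball z δ)) :
    ENNReal.ofReal (π * δ ^ 2) * ‖F z‖ₑ ^ 2 ≤ ∫⁻ w in Metric.ball z δ, ‖F w‖ₑ ^ 2 := by
  simpa [enorm_pow] using enorm_le_lintegral_ball hδ (hF.pow 2)

/-- A function in the Hardy space of a strip is bounded on smaller strips. -/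
theorem exists_norm_le_of_lintegral_le
    (hL : ∀ y : ℝ, |y| < α → ∫⁻ s : ℝ, ‖F (s + y * Complex.I)‖ₑ ^ 2 ≤ ENNReal.ofReal L)
    (hF : DifferentiableOn ℂ F (horizontalStrip α)) {θ : ℝ} (hθ : θ < α) :
    ∃ B : ℝ, ∀ z : ℂ, |z.im| ≤ θ → ‖F z‖ ≤ B := by
  set δ := α - θ
  have hδ : 0 < δ := sub_pos.2 hθ
  set A : ℝ≥0∞ := ENNReal.ofReal L * ENNReal.ofReal (2 * α)
  have hA : A ≠ ∞ := ENNReal.mul_ne_top ENNReal.ofReal_ne_top ENNReal.ofReal_ne_top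
  refine ⟨√(A.toReal / (π * δ ^ 2)), fun z hz => ?_⟩
  have hb : Metric.ball z δ ⊆ horizontalStrip α :=
    ball_subset_horizontalStrip (by simp only [δ]; linarith)
  have h := (enorm_sq_le_lintegral_ball hδ (hF.mono hb)).trans
    ((lintegral_mono_set hb).trans (lintegral_horizontalStrip_le hL hF))
  apply Real.le_sqrt_of_sq_le
  rw [le_div_iff₀ (by positivity)]
  have h2 := ENNReal.toReal_mono hA h
  rw [ENNReal.toReal_mul, ENNReal.toReal_ofReal (by positivity), ENNReal.toReal_pow,
    toReal_enorm] at h2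
  linarith

/-- The values at the integers of a function in the Hardy space of a strip are square summable. -/
theorem summable_norm_sq_int
    (hL : ∀ y : ℝ, |y| < α → ∫⁻ s : ℝ, ‖F (s + y * Complex.I)‖ₑ ^ 2 ≤ ENNReal.ofReal L)
    (hF : DifferentiableOn ℂ F (horizontalStrip α)) (hα : 0 < α) :
    Summable fun k : ℤ => ‖F k‖ ^ 2 := by
  -- Radius at most α keeps the discs about the integers inside the strip; radius at most 1/2 makes
  -- them disjoint, so their area integrals add up to at most that of the strip.
  set δ := min α (1 / 2)
  have hδ : 0 < δ := lt_min hα (by norm_num)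
  have hb : ∀ k : ℤ, Metric.ball (k : ℂ) δ ⊆ horizontalStrip α := fun k =>
    ball_subset_horizontalStrip (by simp [δ])
  have hdisj : Pairwise (Function.onFun Disjoint fun k : ℤ => Metric.ball (k : ℂ) δ) := by
    intro j k hjk
    apply Metric.ball_disjoint_ball
    have h1 : (1 : ℝ) ≤ dist (j : ℂ) (k : ℂ) := by
      rw [dist_eq_norm, ← Int.cast_sub, Complex.norm_intCast]
      exact_mod_cast Int.one_le_abs (sub_ne_zero.2 hjk)
    have : δ ≤ 1 / 2 := min_le_right _ _
    linarith
  have h : ∑' k : ℤ, ENNReal.ofReal (π * δ ^ 2) * ‖F k‖ₑ ^ 2 ≤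
      ENNReal.ofReal L * ENNReal.ofReal (2 * α) := by
    calc _ ≤ ∑' k : ℤ, ∫⁻ w in Metric.ball (k : ℂ) δ, ‖F w‖ₑ ^ 2 :=
          ENNReal.tsum_le_tsum fun k => enorm_sq_le_lintegral_ball hδ (hF.mono (hb k))
      _ = ∫⁻ w in ⋃ k : ℤ, Metric.ball (k : ℂ) δ, ‖F w‖ₑ ^ 2 :=
          (lintegral_iUnion (fun k => Metric.isOpen_ball.measurableSet) hdisj _).symm
      _ ≤ _ := (lintegral_mono_set (iUnion_subset hb)).trans (lintegral_horizontalStrip_le hL hF)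
  rw [ENNReal.tsum_mul_left] at h
  have h3 : ∑' k : ℤ, ‖F k‖ₑ ^ 2 ≠ ∞ := by
    intro h4
    rw [h4, ENNReal.mul_top (by simpa using (by positivity : 0 < π * δ ^ 2))] at h
    exact absurd h (not_le.2 (ENNReal.mul_lt_top ENNReal.ofReal_lt_top ENNReal.ofReal_lt_top))
  have := ENNReal.summable_toReal h3
  simpa using this

end MellinHardy

/-! ### A residue theorem on rectangles -/

namespace MellinHardy

/-- The integral of `h` over the positively oriented boundary of the rectangle
`[-X, X] × [-θ, θ]`. -/
noncomputable def rectIntegral (X θ : ℝ) (h : ℂ → ℂ) : ℂ :=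
  (∫ s : ℝ in (-X)..X, h (s + (-θ : ℝ) * Complex.I)) - (∫ s : ℝ in (-X)..X, h (s + θ * Complex.I)) +
    Complex.I * (∫ y : ℝ in (-θ)..θ, h (X + y * Complex.I)) -
    Complex.I * (∫ y : ℝ in (-θ)..θ, h ((-X : ℝ) + y * Complex.I))

/-- The boundary of the rectangle `[-X, X] × [-θ, θ]`. -/
def rectBoundary (X θ : ℝ) : Set ℂ :=
  {z | |z.re| ≤ X ∧ |z.im| ≤ θ ∧ (|z.re| = X ∨ |z.im| = θ)}

variable {X θ : ℝ}

theorem horizontal_mem_rectBoundary (hX : 0 < X) {y s : ℝ} (hy : |y| = θ)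
    (hs : s ∈ uIcc (-X) X) : (s + y * Complex.I : ℂ) ∈ rectBoundary X θ := by
  rw [uIcc_of_le (by linarith)] at hs
  simp [rectBoundary, hy, abs_le.2 hs]

theorem vertical_mem_rectBoundary (hθ : 0 < θ) {y s : ℝ} (hs : |s| = X)
    (hy : y ∈ uIcc (-θ) θ) : (s + y * Complex.I : ℂ) ∈ rectBoundary X θ := by
  rw [uIcc_of_le (by linarith)] at hy
  simp [rectBoundary, hs, abs_le.2 hy]

theorem intervalIntegrable_horizontal (hX : 0 < X) {h : ℂ → ℂ}
    (hh : ContinuousOn h (rectBoundary X θ)) {y : ℝ} (hy : |y| = θ) :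
    IntervalIntegrable (fun s : ℝ => h (s + y * Complex.I)) volume (-X) X :=
  (hh.comp (by fun_prop) fun _ hs => horizontal_mem_rectBoundary hX hy hs).intervalIntegrable

theorem intervalIntegrable_vertical (hθ : 0 < θ) {h : ℂ → ℂ}
    (hh : ContinuousOn h (rectBoundary X θ)) {s : ℝ} (hs : |s| = X) :
    IntervalIntegrable (fun y : ℝ => h (s + y * Complex.I)) volume (-θ) θ :=
  (hh.comp (by fun_prop) fun _ hy => vertical_mem_rectBoundary hθ hs hy).intervalIntegrable

theorem rectIntegral_congr (hX : 0 < X) (hθ : 0 < θ) {h g : ℂ → ℂ}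
    (hg : EqOn h g (rectBoundary X θ)) : rectIntegral X θ h = rectIntegral X θ g := by
  have h1 : ∀ y : ℝ, |y| = θ → ∫ s : ℝ in (-X)..X, h (s + y * Complex.I) =
      ∫ s : ℝ in (-X)..X, g (s + y * Complex.I) := fun y hy =>
    intervalIntegral.integral_congr fun s hs => hg (horizontal_mem_rectBoundary hX hy hs)
  have h2 : ∀ s : ℝ, |s| = X → ∫ y : ℝ in (-θ)..θ, h (s + y * Complex.I) =
      ∫ y : ℝ in (-θ)..θ, g (s + y * Complex.I) := fun s hs =>
    intervalIntegral.integral_congr fun y hy => hg (vertical_mem_rectBoundary hθ hs hy)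
  rw [rectIntegral, rectIntegral, h1 (-θ) (by simp [abs_of_pos hθ]), h1 θ (abs_of_pos hθ),
    h2 X (abs_of_pos hX), h2 (-X) (by simp [abs_of_pos hX])]

theorem rectIntegral_sub (hX : 0 < X) (hθ : 0 < θ) {h g : ℂ → ℂ}
    (hh : ContinuousOn h (rectBoundary X θ)) (hg : ContinuousOn g (rectBoundary X θ)) :
    rectIntegral X θ (fun z => h z - g z) = rectIntegral X θ h - rectIntegral X θ g := by
  have e1 : |(-θ)| = θ := by simp [abs_of_pos hθ]
  have e2 : |(-X)| = X := by simp [abs_of_pos hX]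
  have e3 := abs_of_pos hθ
  have e4 := abs_of_pos hX
  simp only [rectIntegral]
  rw [intervalIntegral.integral_sub (intervalIntegrable_horizontal hX hh e1)
      (intervalIntegrable_horizontal hX hg e1),
    intervalIntegral.integral_sub (intervalIntegrable_horizontal hX hh e3)
      (intervalIntegrable_horizontal hX hg e3),
    intervalIntegral.integral_sub (intervalIntegrable_vertical hθ hh e4)
      (intervalIntegrable_vertical hθ hg e4),
    intervalIntegral.integral_sub (intervalIntegrable_vertical hθ hh e2)
      (intervalIntegrable_vertical hθ hg e2)]
  ring

theorem rectIntegral_sum (hX : 0 < X) (hθ : 0 < θ) {ι : Type*} (P : Finset ι) {h : ι → ℂ → ℂ}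
    (hh : ∀ i ∈ P, ContinuousOn (h i) (rectBoundary X θ)) :
    rectIntegral X θ (fun z => ∑ i ∈ P, h i z) = ∑ i ∈ P, rectIntegral X θ (h i) := by
  have e1 : |(-θ)| = θ := by simp [abs_of_pos hθ]
  have e2 : |(-X)| = X := by simp [abs_of_pos hX]
  have e3 := abs_of_pos hθ
  have e4 := abs_of_pos hX
  simp only [rectIntegral]
  rw [intervalIntegral.integral_finsetSum fun i hi => intervalIntegrable_horizontal hX (hh i hi) e1,
    intervalIntegral.integral_finsetSum fun i hi => intervalIntegrable_horizontal hX (hh i hi) e3,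
    intervalIntegral.integral_finsetSum fun i hi => intervalIntegrable_vertical hθ (hh i hi) e4,
    intervalIntegral.integral_finsetSum fun i hi => intervalIntegrable_vertical hθ (hh i hi) e2,
    Finset.mul_sum, Finset.mul_sum, ← Finset.sum_sub_distrib, ← Finset.sum_add_distrib,
    ← Finset.sum_sub_distrib]

theorem rectIntegral_const_mul (c : ℂ) (h : ℂ → ℂ) :
    rectIntegral X θ (fun z => c * h z) = c * rectIntegral X θ h := by
  simp only [rectIntegral, intervalIntegral.integral_const_mul]
  ring

theorem rectIntegral_eq_zero (hX : 0 < X) (hθ : 0 < θ) {h : ℂ → ℂ}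
    (hh : DifferentiableOn ℂ h {z | |z.re| ≤ X ∧ |z.im| ≤ θ}) : rectIntegral X θ h = 0 := by
  have := Complex.integral_boundary_rect_eq_zero_of_differentiableOn h
    ⟨-X, -θ⟩ ⟨X, θ⟩ (hh.mono ?_)
  · simpa [rectIntegral] using this
  · intro z hz
    simp only [uIcc_of_le (by linarith : -X ≤ X), uIcc_of_le (by linarith : -θ ≤ θ)] at hz
    exact ⟨abs_le.2 hz.1, abs_le.2 hz.2⟩

theorem log_sub_log_neg {w : ℂ} (hw : 0 < w.im) : Complex.log w - Complex.log (-w) = π * Complex.I := by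
  rw [Complex.log, Complex.log, norm_neg, Complex.arg_neg_eq_arg_sub_pi_of_im_pos hw]
  push_cast
  ring

/-- The principal logarithm of z - p is a primitive along the bottom, right and top sides. The left
side crosses its branch cut, so log(-(z - p)) serves there. The two branches differ by πi at each
left corner, with signs that add up to 2πi. -/
theorem rectIntegral_inv {p : ℂ} (h1 : |p.re| < X) (h2 : |p.im| < θ) :
    rectIntegral X θ (fun z => (z - p)⁻¹) = 2 * π * Complex.I := by
  rw [abs_lt] at h1 h2
  have hor : ∀ y : ℝ, y ≠ p.im → ∫ s : ℝ in (-X)..X, ((s + y * Complex.I : ℂ) - p)⁻¹ =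
      Complex.log (X + y * Complex.I - p) - Complex.log ((-X : ℝ) + y * Complex.I - p) := by
    intro y hy
    have hm : ∀ s : ℝ, (s + y * Complex.I - p : ℂ) ∈ Complex.slitPlane := fun s =>
      Complex.mem_slitPlane_iff.2 (Or.inr (by simpa using sub_ne_zero.2 hy))
    apply intervalIntegral.integral_eq_sub_of_hasDerivAt
    · intro s _
      have := ((((hasDerivAt_id (s : ℂ)).add_const (y * Complex.I)).sub_const p).clog (hm s)).comp_ofReal
      simpa using this
    · apply ContinuousOn.intervalIntegrable
      apply ContinuousOn.inv₀ (by fun_prop)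
      exact fun s _ => Complex.slitPlane_ne_zero (hm s)
  have ver : ∀ (s : ℝ) (e : ℂ), e ^ 2 = 1 → 0 < (e * (s - p)).re → e.im = 0 →
      Complex.I * ∫ y : ℝ in (-θ)..θ, ((s + y * Complex.I : ℂ) - p)⁻¹ =
      Complex.log (e * (s + θ * Complex.I - p)) -
        Complex.log (e * (s + (-θ : ℝ) * Complex.I - p)) := by
    intro s e he hs he0
    have hm : ∀ y : ℝ, (e * (s + y * Complex.I - p) : ℂ) ∈ Complex.slitPlane := fun y =>
      Complex.mem_slitPlane_iff.2 (Or.inl (by simpa [he0] using hs))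
    rw [← intervalIntegral.integral_const_mul]
    apply intervalIntegral.integral_eq_sub_of_hasDerivAt
      (f := fun y : ℝ => Complex.log (e * (s + y * Complex.I - p)))
    · intro y _
      have := (((((hasDerivAt_id (y : ℂ)).mul_const Complex.I).const_add (s : ℂ)).sub_const
        p).const_mul e).clog (hm y)
      have := this.comp_ofReal
      have e0 : e ≠ 0 := by rintro rfl; simp at he
      rw [one_mul, mul_div_mul_left _ _ e0, div_eq_mul_inv] at this
      exact this
    · apply ContinuousOn.intervalIntegrable
      apply ContinuousOn.mul continuousOn_const
      apply ContinuousOn.inv₀ (by fun_prop)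
      exact fun y _ => right_ne_zero_of_mul (Complex.slitPlane_ne_zero (hm y))
  rw [rectIntegral, hor _ h2.1.ne, hor _ h2.2.ne',
    ver X 1 (by simp) (by simpa using h1.2) (by simp),
    ver (-X) (-1) (by simp) (by simp; linarith) (by simp)]
  have l1 := log_sub_log_neg (w := (-X : ℝ) + θ * Complex.I - p) (by simpa using h2.2)
  have l2 := log_sub_log_neg (w := -((-X : ℝ) + (-θ : ℝ) * Complex.I - p)) (by simp; linarith)
  rw [neg_neg] at l2
  simp only [one_mul, neg_one_mul]
  linear_combination l1 + l2

/-- A quotient of holomorphic functions whose denominator has only simple zeros, each of them a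
zero of the numerator, extends holomorphically. -/
theorem differentiableAt_quotient {E s : ℂ → ℂ} {U : Set ℂ} (hU : IsOpen U)
    (hE : DifferentiableOn ℂ E U) (hs : DifferentiableOn ℂ s U) {z : ℂ} (hz : z ∈ U)
    (h : s z = 0 → E z = 0 ∧ deriv s z ≠ 0) :
    DifferentiableAt ℂ (fun w => if s w = 0 then deriv E w / deriv s w else E w / s w) z := by
  have hn := hU.mem_nhds hz
  have hsz := hs.differentiableAt hn
  by_cases h0 : s z = 0
  · obtain ⟨hE0, hd⟩ := h h0
    -- Near a common zero z, numerator and denominator are both divided by w - z; the new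
    -- denominator has the nonzero value s'(z) at z.
    have d1 := ((Complex.differentiableOn_dslope hn).2 hE).differentiableAt hn
    have d2 := ((Complex.differentiableOn_dslope hn).2 hs).differentiableAt hn
    refine (d1.div d2 (by rwa [dslope_same])).congr_of_eventuallyEq ?_
    have := hsz.hasDerivAt.eventually_ne (c := 0) hd
    rw [eventually_nhdsWithin_iff] at this
    filter_upwards [this] with w hw
    by_cases hwz : w = z
    · subst hwz
      simp [h0]
    · rw [if_neg (hw hwz), Pi.div_apply, dslope_of_ne _ hwz, dslope_of_ne _ hwz, slope_def_field,
        slope_def_field, hE0, h0, sub_zero, sub_zero, div_div_div_cancel_right₀ (sub_ne_zero.2 hwz)]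
  · refine ((hE.differentiableAt hn).div hsz h0).congr_of_eventuallyEq ?_
    filter_upwards [hsz.continuousAt.eventually_ne h0] with w hw
    rw [if_neg hw, Pi.div_apply]

/-- The residue theorem on a rectangle for a quotient whose denominator has simple zeros. -/
theorem rectIntegral_div (hX : 0 < X) (hθ : 0 < θ) {F s : ℂ → ℂ} {U : Set ℂ} (hU : IsOpen U)
    (hrect : {z : ℂ | |z.re| ≤ X ∧ |z.im| ≤ θ} ⊆ U) (hF : DifferentiableOn ℂ F U)
    (hs : DifferentiableOn ℂ s U) (P : Finset ℂ) (hP : ∀ p ∈ P, |p.re| < X ∧ |p.im| < θ)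
    (h0 : ∀ p ∈ P, s p = 0) (h1 : ∀ p ∈ P, deriv s p ≠ 0)
    (h2 : ∀ z : ℂ, |z.re| ≤ X → |z.im| ≤ θ → s z = 0 → z ∈ P) :
    rectIntegral X θ (fun z => F z / s z) =
      2 * π * Complex.I * ∑ p ∈ P, F p / deriv s p := by
  have hPU : ∀ p ∈ P, U ∈ 𝓝 p := fun p hp =>
    hU.mem_nhds (hrect ⟨(hP p hp).1.le, (hP p hp).2.le⟩)
  -- Off p, `dslope s p` is s(z)/(z - p), and at p it is s'(p). Hence E vanishes on P, while E/s on
  -- the boundary is F/s minus its principal parts. The holomorphic extension of E/s then has zero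
  -- integral.
  set E : ℂ → ℂ := fun z => F z - ∑ p ∈ P, F p / deriv s p * dslope s p z with hEdef
  have hE : DifferentiableOn ℂ E U := by
    apply hF.sub
    apply DifferentiableOn.fun_sum
    intro p hp
    exact ((Complex.differentiableOn_dslope (hPU p hp)).2 hs).const_mul _
  have hEP : ∀ p ∈ P, E p = 0 := by
    intro q hq
    simp only [hEdef]
    rw [Finset.sum_eq_single q]
    · rw [dslope_same, div_mul_cancel₀ _ (h1 q hq), sub_self]
    · intro p hp hpq
      rw [dslope_of_ne _ hpq.symm, slope_def_field, h0 p hp, h0 q hq]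
      simp
    · exact fun h => absurd hq h
  have hz := rectIntegral_eq_zero hX hθ
    (h := fun w => if s w = 0 then deriv E w / deriv s w else E w / s w) (by
      intro z hz
      refine (differentiableAt_quotient hU hE hs (hrect hz) fun hs0 => ?_).differentiableWithinAt
      have := h2 z hz.1 hz.2 hs0
      exact ⟨hEP z this, h1 z this⟩)
  have hb : ∀ z ∈ rectBoundary X θ, ∀ p ∈ P, z - p ≠ 0 := by
    rintro z ⟨-, -, hz⟩ p hp h
    rw [sub_eq_zero.1 h] at hz
    have := hP p hp
    rcases hz with hz | hz <;> linarith
  have hbs : ∀ z ∈ rectBoundary X θ, s z ≠ 0 := by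
    intro z hz h
    exact hb z hz z (h2 z hz.1 hz.2.1 h) (sub_self z)
  have hbU : rectBoundary X θ ⊆ U := fun z hz => hrect ⟨hz.1, hz.2.1⟩
  rw [rectIntegral_congr hX hθ (g := fun z => F z / s z - ∑ p ∈ P, F p / deriv s p * (z - p)⁻¹),
    rectIntegral_sub hX hθ, rectIntegral_sum hX hθ] at hz
  · rw [sub_eq_zero.1 hz, Finset.mul_sum]
    refine Finset.sum_congr rfl fun p hp => ?_
    rw [rectIntegral_const_mul, rectIntegral_inv (hP p hp).1 (hP p hp).2]
    ring
  · intro p hp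
    exact continuousOn_const.mul ((continuousOn_id.sub continuousOn_const).inv₀
      fun z hz => hb z hz p hp)
  · exact (hF.continuousOn.mono hbU).div (hs.continuousOn.mono hbU) hbs
  · apply continuousOn_finsetSum
    intro p hp
    exact continuousOn_const.mul ((continuousOn_id.sub continuousOn_const).inv₀
      fun z hz => hb z hz p hp)
  · intro z hz
    simp only [if_neg (hbs z hz), hEdef, sub_div, Finset.sum_div]
    congr 1
    refine Finset.sum_congr rfl fun p hp => ?_
    have hne := hb z hz p hp
    rw [dslope_of_ne _ (sub_ne_zero.1 hne), slope_def_field, h0 p hp, sub_zero]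
    have := hbs z hz
    field_simp

end MellinHardy

/-! ### The error of the cardinal series on a strip -/

namespace MellinHardy

variable {F : ℂ → ℂ} {α L : ℝ}

/-- This follows from |sin(x + iy)|² = sin² x + sinh² y. -/
theorem sinh_le_norm_sin {x y : ℝ} : |Real.sinh y| ≤ ‖Complex.sin (x + y * Complex.I)‖ := by
  refine abs_le_of_sq_le_sq ?_ (norm_nonneg _)
  rw [← Complex.normSq_eq_norm_sq, Complex.sin_add_mul_I, ← Complex.ofReal_sin,
    ← Complex.ofReal_cos, ← Complex.ofReal_sinh, ← Complex.ofReal_cosh, ← Complex.ofReal_mul,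
    ← Complex.ofReal_mul, Complex.normSq_add_mul_I]
  nlinarith [Real.cosh_sq y, Real.sin_sq_add_cos_sq x, sq_nonneg (Real.sin x), sq_nonneg (Real.sinh y)]

theorem abs_sin_le_norm_sin {x y : ℝ} : |Real.sin x| ≤ ‖Complex.sin (x + y * Complex.I)‖ := by
  refine le_trans ?_ (Complex.abs_re_le_norm _)
  rw [Complex.sin_add_mul_I, ← Complex.ofReal_sin, ← Complex.ofReal_cos, ← Complex.ofReal_sinh,
    ← Complex.ofReal_cosh, ← Complex.ofReal_mul, ← Complex.ofReal_mul]
  simp only [Complex.add_re, Complex.ofReal_re, Complex.re_ofReal_mul, Complex.I_re, mul_zero,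
    add_zero, abs_mul, abs_of_pos (Real.cosh_pos y)]
  exact le_mul_of_one_le_right (abs_nonneg _) (Real.one_le_cosh y)

theorem integral_inv_sq_add_sq_le {θ : ℝ} (hθ : 0 < θ) (t X : ℝ) :
    ∫ s in (-X)..X, ((s - t) ^ 2 + θ ^ 2)⁻¹ ≤ π / θ := by
  have h : ∀ s : ℝ, HasDerivAt (fun s => Real.arctan ((s - t) / θ) / θ) ((s - t) ^ 2 + θ ^ 2)⁻¹ s := by
    intro s
    have := ((((hasDerivAt_id' s).sub_const t).div_const θ).arctan).div_const θ
    refine this.congr_deriv ?_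
    have h1 : (s - t) ^ 2 + θ ^ 2 ≠ 0 := by positivity
    field_simp
    ring
  rw [intervalIntegral.integral_eq_sub_of_hasDerivAt (fun s _ => h s)]
  · rw [← sub_div]
    gcongr
    linarith [Real.arctan_lt_pi_div_two ((X - t) / θ), Real.neg_pi_div_two_lt_arctan ((-X - t) / θ)]
  · apply Continuous.intervalIntegrable
    apply Continuous.inv₀ (by fun_prop)
    intro s
    positivity

theorem integral_norm_sq_le (hL0 : 0 ≤ L)
    (hL : ∀ y : ℝ, |y| < α → ∫⁻ s : ℝ, ‖F (s + y * Complex.I)‖ₑ ^ 2 ≤ ENNReal.ofReal L)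
    {X y : ℝ} (hX : 0 < X) (hy : |y| < α) :
    ∫ s in (-X)..X, ‖F (s + y * Complex.I)‖ ^ 2 ≤ L := by
  rw [intervalIntegral.integral_of_le (by linarith)]
  -- Without measurability the Bochner integral is 0 by convention, and the bound is trivial.
  by_cases hi : AEStronglyMeasurable (fun s : ℝ => ‖F (s + y * Complex.I)‖ ^ 2)
      (volume.restrict (Ioc (-X) X))
  · rw [integral_eq_lintegral_of_nonneg_ae (Eventually.of_forall fun s => by positivity) hi]
    apply ENNReal.toReal_le_of_le_ofReal hL0
    refine le_trans (setLIntegral_le_lintegral _ _) (le_trans (le_of_eq ?_) (hL y hy))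
    congr 1 with s
    rw [ENNReal.ofReal_pow (norm_nonneg _), ofReal_norm]
  · rw [integral_undef fun h => hi h.1]
    exact hL0

theorem continuous_line (hF : DifferentiableOn ℂ F (horizontalStrip α)) {y : ℝ} (hy : |y| < α) :
    Continuous fun s : ℝ => F (s + y * Complex.I) :=
  hF.continuousOn.comp_continuous (by fun_prop) fun s => by simpa [horizontalStrip] using hy

/-- The partial sums of the cardinal series as contour integrals. -/
theorem rectIntegral_sampling (hF : DifferentiableOn ℂ F (horizontalStrip α)) {θ t : ℝ}
    (hθ : 0 < θ) (hθα : θ < α) (ht : Real.sin (π * t) ≠ 0) {N : ℕ} (hN : |t| < N + 1 / 2) :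
    rectIntegral (N + 1 / 2) θ (fun z => F z / (Complex.sin (π * z) * (z - t))) * Real.sin (π * t) =
      2 * π * Complex.I *
        (F t - ∑ k ∈ Finset.Icc (-N : ℤ) N, F k * (Real.sinc (π * (t - k)) : ℝ)) := by
  have hπ : (π : ℂ) ≠ 0 := Complex.ofReal_ne_zero.2 pi_ne_zero
  have htk : ∀ k : ℤ, t ≠ k := by
    rintro k rfl
    exact ht (by rw [mul_comm]; exact Real.sin_int_mul_pi k)
  have hder : ∀ z : ℂ, HasDerivAt (fun z : ℂ => Complex.sin (π * z) * (z - t))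
      (Complex.cos (π * z) * π * (z - t) + Complex.sin (π * z)) z := by
    intro z
    have h1 : HasDerivAt (fun z : ℂ => (π : ℂ) * z) π z := by
      simpa using (hasDerivAt_id z).const_mul (π : ℂ)
    exact (h1.csin.mul ((hasDerivAt_id' z).sub_const (t : ℂ))).congr_deriv (by rw [mul_one])
  have hsk : ∀ k : ℤ, Complex.sin (π * k) = 0 := fun k => by
    rw [mul_comm]; exact Complex.sin_int_mul_pi k
  have hck : ∀ k : ℤ, Complex.cos (π * k) ^ 2 = 1 := fun k => by
    rw [Complex.cos_sq', hsk]; simp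
  have hck0 : ∀ k : ℤ, Complex.cos (π * k) ≠ 0 := fun k h => by simpa [h] using hck k
  have hdk : ∀ k : ℤ, deriv (fun z : ℂ => Complex.sin (π * z) * (z - t)) k =
      Complex.cos (π * k) * π * (k - t) := fun k => by
    rw [(hder k).deriv, hsk, add_zero]
  have hdt : deriv (fun z : ℂ => Complex.sin (π * z) * (z - t)) t = Real.sin (π * t) := by
    rw [(hder t).deriv]; simp
  have htC : ((Real.sin (π * t) : ℝ) : ℂ) ≠ 0 := Complex.ofReal_ne_zero.2 ht
  have hktC : ∀ k : ℤ, (k : ℂ) - t ≠ 0 := fun k => sub_ne_zero.2 (by exact_mod_cast (htk k).symm)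
  classical
  -- The zeros of sin(πz)(z - t) in the rectangle; all are simple because t is not an integer.
  set P : Finset ℂ := insert (t : ℂ) ((Finset.Icc (-N : ℤ) N).image (fun k : ℤ => (k : ℂ))) with hP
  have hPmem : ∀ p : ℂ, p ∈ P ↔ p = t ∨ ∃ k : ℤ, (-N ≤ k ∧ k ≤ N) ∧ (k : ℂ) = p := by
    intro p; simp [hP]
  have hres := rectIntegral_div (X := N + 1 / 2) (by positivity) hθ (F := F)
    (s := fun z => Complex.sin (π * z) * (z - t)) (isOpen_horizontalStrip α)
    (fun z hz => lt_of_le_of_lt hz.2 hθα) hF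
    (fun z _ => (hder z).differentiableAt.differentiableWithinAt) P ?_ ?_ ?_ ?_
  · rw [hres, hP, Finset.sum_insert, Finset.sum_image, hdt]
    · rw [mul_assoc, add_mul, div_mul_cancel₀ _ htC, Finset.sum_mul, sub_eq_add_neg,
        ← Finset.sum_neg_distrib]
      congr 2
      refine Finset.sum_congr rfl fun k _ => ?_
      have h1 : π * (t - k) ≠ 0 := mul_ne_zero pi_ne_zero (sub_ne_zero.2 (htk k))
      have h2 : ((t : ℂ) - k) ≠ 0 := sub_ne_zero.2 (by exact_mod_cast htk k)
      rw [hdk, Real.sinc_of_ne_zero h1]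
      push_cast
      -- The residue at k is F(k)/(π cos(πk)(k - t)). Since sin(π(t - k)) = sin(πt) cos(πk) and
      -- cos²(πk) = 1, multiplying by sin(πt) gives -F(k) sinc(π(t - k)) in normalised form.
      rw [mul_sub (π : ℂ) t, Complex.sin_sub, hsk]
      have h3 := hktC k
      have h4 := hck0 k
      have h5 : (π : ℂ) * t - π * k ≠ 0 := by rw [← mul_sub]; exact mul_ne_zero hπ h2
      field_simp
      linear_combination (F k * Complex.sin (π * t) * (k - t)) * hck k
    · exact fun j _ k _ h => by exact_mod_cast h
    · simp only [Finset.mem_image, not_exists, not_and]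
      intro k _ h
      exact htk k (by exact_mod_cast h.symm)
  · intro p hp
    rcases (hPmem p).1 hp with rfl | ⟨k, hk, rfl⟩
    · simpa using ⟨by simpa using hN, hθ⟩
    · have h1 : |(k : ℝ)| ≤ N := by exact_mod_cast abs_le.2 hk
      constructor
      · simp only [Complex.intCast_re]; linarith
      · simpa using hθ
  · intro p hp
    rcases (hPmem p).1 hp with rfl | ⟨k, hk, rfl⟩
    · simp
    · simp [hsk]
  · intro p hp
    rcases (hPmem p).1 hp with rfl | ⟨k, hk, rfl⟩
    · rwa [hdt]
    · rw [hdk]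
      exact mul_ne_zero (mul_ne_zero (hck0 k) hπ) (hktC k)
  · intro z hz1 hz2 h
    rw [hPmem]
    rcases mul_eq_zero.1 h with h | h
    · right
      obtain ⟨k, hk⟩ := Complex.sin_eq_zero_iff.1 h
      have hzk : (k : ℂ) = z := by
        rw [mul_comm] at hk; exact (mul_right_cancel₀ hπ hk).symm
      refine ⟨k, ?_, hzk⟩
      rw [← hzk, Complex.intCast_re] at hz1
      have h3 : |k| < (N : ℤ) + 1 := by
        have : (|k| : ℝ) < N + 1 := by linarith
        exact_mod_cast this
      rw [← abs_le]
      omega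
    · left
      exact sub_eq_zero.1 h

/-- With A = |F(z)| and D = |z - t|, AM-GM gives 2A/D ≤ lA² + 1/(lD²). The first term is controlled
by the L² bound, the second by the arctangent integral. The weight l stays free so that it can later
balance the growth of L with T. -/
theorem norm_integral_horizontal_le (hL0 : 0 ≤ L)
    (hL : ∀ y : ℝ, |y| < α → ∫⁻ s : ℝ, ‖F (s + y * Complex.I)‖ₑ ^ 2 ≤ ENNReal.ofReal L)
    (hF : DifferentiableOn ℂ F (horizontalStrip α)) {θ t X l y : ℝ} (hθ : 0 < θ) (hθα : θ < α)
    (hX : 0 < X) (hl : 0 < l) (hy : |y| = θ) :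
    ‖∫ s : ℝ in (-X)..X, F (s + y * Complex.I) /
        (Complex.sin (π * (s + y * Complex.I)) * (s + y * Complex.I - t))‖ ≤
      (l * L + l⁻¹ * (π / θ)) / (2 * Real.sinh (π * θ)) := by
  have hy' : |y| < α := hy.trans_lt hθα
  have hy2 : y ^ 2 = θ ^ 2 := by rw [← sq_abs, hy]
  have hsh : 0 < Real.sinh (π * θ) := Real.sinh_pos_iff.2 (by positivity)
  have hc1 := continuous_line hF hy'
  have hc2 : Continuous fun s : ℝ => ((s - t) ^ 2 + θ ^ 2)⁻¹ :=
    Continuous.inv₀ (by fun_prop) fun s => by positivity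
  have hpt : ∀ s : ℝ, ‖F (s + y * Complex.I) /
        (Complex.sin (π * (s + y * Complex.I)) * (s + y * Complex.I - t))‖ ≤
      (2 * Real.sinh (π * θ))⁻¹ *
        (l * ‖F (s + y * Complex.I)‖ ^ 2 + l⁻¹ * ((s - t) ^ 2 + θ ^ 2)⁻¹) := by
    intro s
    have h1 : Real.sinh (π * θ) ≤ ‖Complex.sin (π * (s + y * Complex.I))‖ := by
      have := sinh_le_norm_sin (x := π * s) (y := π * y)
      rw [Real.abs_sinh, abs_mul, abs_of_pos pi_pos, hy] at this
      convert this using 3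
      push_cast; ring
    have h2 : ‖(s + y * Complex.I - t : ℂ)‖ ^ 2 = (s - t) ^ 2 + θ ^ 2 := by
      rw [← Complex.normSq_eq_norm_sq, ← hy2, ← Complex.normSq_add_mul_I]
      congr 1; push_cast; ring
    have h3 : 0 < ‖(s + y * Complex.I - t : ℂ)‖ := by
      refine (norm_nonneg _).lt_of_ne fun h => ?_
      rw [← h] at h2
      have : 0 < (s - t) ^ 2 + θ ^ 2 := by positivity
      linarith
    rw [norm_div, norm_mul, ← h2]
    set A := ‖F (s + y * Complex.I)‖
    set D := ‖(s + y * Complex.I - t : ℂ)‖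
    calc A / (‖Complex.sin (π * (s + y * Complex.I))‖ * D) ≤ A / (Real.sinh (π * θ) * D) := by
          gcongr
      _ = (2 * Real.sinh (π * θ))⁻¹ * (2 * (A * D⁻¹)) := by field_simp
      _ ≤ _ := by
          gcongr
          have h4 : l * A ^ 2 + l⁻¹ * (D ^ 2)⁻¹ - 2 * (A * D⁻¹) = l * (A - l⁻¹ * D⁻¹) ^ 2 := by
            field_simp; ring
          nlinarith [mul_nonneg hl.le (sq_nonneg (A - l⁻¹ * D⁻¹))]
  have hi1 : IntervalIntegrable (fun s : ℝ => l * ‖F (s + y * Complex.I)‖ ^ 2) volume (-X) X :=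
    ((hc1.norm.pow 2).const_mul l).intervalIntegrable _ _
  have hi2 : IntervalIntegrable (fun s : ℝ => l⁻¹ * ((s - t) ^ 2 + θ ^ 2)⁻¹) volume (-X) X :=
    (hc2.const_mul l⁻¹).intervalIntegrable _ _
  refine (intervalIntegral.norm_integral_le_of_norm_le (by linarith) (Eventually.of_forall fun s _ => hpt s)
    (((hi1.add hi2).const_mul _))).trans ?_
  rw [intervalIntegral.integral_const_mul, intervalIntegral.integral_add hi1 hi2,
    intervalIntegral.integral_const_mul, intervalIntegral.integral_const_mul, div_eq_inv_mul]
  gcongr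
  · exact integral_norm_sq_le hL0 hL hX hy'
  · exact integral_inv_sq_add_sq_le hθ t X

/-- At a half-integer abscissa |sin(πX)| = 1, so |sin(πz)| ≥ 1 on the whole side; the decay in N
comes from |z - t| ≥ N + 1/2 - |t|. -/
theorem norm_integral_vertical_le {θ t B : ℝ} (hθ : 0 < θ)
    (hB : ∀ z : ℂ, |z.im| ≤ θ → ‖F z‖ ≤ B) {N : ℕ} (hN : |t| < N + 1 / 2) {X : ℝ}
    (hX : |X| = N + 1 / 2) :
    ‖∫ y : ℝ in (-θ)..θ, F (X + y * Complex.I) /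
        (Complex.sin (π * (X + y * Complex.I)) * (X + y * Complex.I - t))‖ ≤
      B / (N + 1 / 2 - |t|) * (2 * θ) := by
  have hd : 0 < (N + 1 / 2 - |t| : ℝ) := sub_pos.2 hN
  have hsin : |Real.sin (π * X)| = 1 := by
    have h1 : |Real.sin (π * X)| = |Real.sin (π * |X|)| := by
      rcases abs_choice X with h | h <;> simp [h]
    have h2 : Real.sin (π * (N + 1 / 2)) = Real.cos (N * π) := by
      rw [← Real.sin_add_pi_div_two]; congr 1; ring
    rw [h1, hX, h2, Real.cos_nat_mul_pi]
    simp
  have := intervalIntegral.norm_integral_le_of_norm_le_const (a := -θ) (b := θ)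
    (C := B / (N + 1 / 2 - |t|)) (f := fun y : ℝ => F (X + y * Complex.I) /
        (Complex.sin (π * (X + y * Complex.I)) * (X + y * Complex.I - t))) ?_
  · refine this.trans (le_of_eq ?_)
    rw [sub_neg_eq_add, abs_of_pos (show 0 < θ + θ by linarith)]; ring
  · intro y hy
    rw [uIoc_of_le (by linarith)] at hy
    have h1 := hB (X + y * Complex.I) (by simpa using abs_le.2 ⟨hy.1.le, hy.2⟩)
    have h2 : 1 ≤ ‖Complex.sin (π * (X + y * Complex.I))‖ := by
      have := abs_sin_le_norm_sin (x := π * X) (y := π * y)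
      rw [hsin] at this
      convert this using 3
      push_cast; ring
    have h3 : N + 1 / 2 - |t| ≤ ‖(X + y * Complex.I - t : ℂ)‖ := by
      refine le_trans ?_ (Complex.abs_re_le_norm _)
      simp only [Complex.sub_re, Complex.add_re, Complex.ofReal_re, Complex.re_ofReal_mul,
        Complex.I_re, mul_zero, add_zero]
      have := abs_sub_abs_le_abs_sub X t
      linarith
    rw [norm_div, norm_mul]
    have hB0 : 0 ≤ B := (norm_nonneg _).trans h1
    gcongr
    nlinarith

theorem summable_sinc_sq (t : ℝ) : Summable fun k : ℤ => Real.sinc (π * (t - k)) ^ 2 := by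
  apply Summable.of_norm_bounded_eventually (Real.summable_one_div_int_pow.2 one_lt_two)
  have h1 : Tendsto (fun k : ℤ => ‖(k : ℝ)‖) cofinite atTop :=
    tendsto_norm_cocompact_atTop.comp Int.tendsto_coe_cofinite
  filter_upwards [h1.eventually_gt_atTop (2 * |t|)] with k hk
  rw [Real.norm_eq_abs] at hk
  have hk0 : 0 < |(k : ℝ)| := lt_of_le_of_lt (by positivity) hk
  have h2 : |(k : ℝ)| / 2 ≤ |t - k| := by
    have := abs_sub_abs_le_abs_sub (k : ℝ) t
    rw [abs_sub_comm] at this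
    linarith
  have h3 : |(k : ℝ)| ≤ |π * (t - k)| := by
    rw [abs_mul, abs_of_pos pi_pos]
    nlinarith [pi_gt_three, abs_nonneg (t - k)]
  have h4 : π * (t - k) ≠ 0 := abs_pos.1 (hk0.trans_le h3)
  rw [Real.norm_of_nonneg (sq_nonneg _), Real.sinc_of_ne_zero h4, div_pow, ← sq_abs (k : ℝ),
    ← sq_abs (π * (t - k))]
  gcongr
  exact Real.sin_sq_le_one _

theorem summable_sampling (hα : 0 < α)
    (hL : ∀ y : ℝ, |y| < α → ∫⁻ s : ℝ, ‖F (s + y * Complex.I)‖ₑ ^ 2 ≤ ENNReal.ofReal L)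
    (hF : DifferentiableOn ℂ F (horizontalStrip α)) (t : ℝ) :
    Summable fun k : ℤ => F k * (Real.sinc (π * (t - k)) : ℝ) := by
  apply Summable.of_norm_bounded ((summable_norm_sq_int hL hF hα).add (summable_sinc_sq t))
  intro k
  rw [norm_mul, Complex.norm_real, Real.norm_eq_abs, ← sq_abs (Real.sinc _)]
  nlinarith [sq_nonneg (‖F k‖ - |Real.sinc (π * (t - k))|), sq_nonneg ‖F k‖,
    sq_nonneg |Real.sinc (π * (t - k))|]

/-- The contour stays at height θ < α, where F is bounded, while N → ∞ along symmetric partial sums.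
-/
theorem norm_sub_tsum_sampling_le_aux (hα : 0 < α) (hL0 : 0 ≤ L)
    (hL : ∀ y : ℝ, |y| < α → ∫⁻ s : ℝ, ‖F (s + y * Complex.I)‖ₑ ^ 2 ≤ ENNReal.ofReal L)
    (hF : DifferentiableOn ℂ F (horizontalStrip α)) {θ l : ℝ} (hθ : 0 < θ) (hθα : θ < α)
    (hl : 0 < l) (t : ℝ) :
    ‖F t - ∑' k : ℤ, F k * (Real.sinc (π * (t - k)) : ℝ)‖ ≤
      (l * L + l⁻¹ * (π / θ)) / (2 * Real.sinh (π * θ)) := by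
  have hsh : 0 < Real.sinh (π * θ) := Real.sinh_pos_iff.2 (by positivity)
  set C := (l * L + l⁻¹ * (π / θ)) / (2 * Real.sinh (π * θ)) with hC
  have hC0 : 0 ≤ C := by positivity
  by_cases ht : Real.sin (π * t) = 0
  · obtain ⟨m, hm⟩ := Real.sin_eq_zero_iff.1 ht
    have htm : t = m := by
      rw [mul_comm] at hm; exact (mul_left_cancel₀ pi_ne_zero hm).symm
    -- At an integer t = m only the term k = m survives, and the error is 0.
    rw [tsum_eq_single m]
    · rw [htm]; simpa using hC0
    · intro k hk
      have h1 : π * (t - k) ≠ 0 := by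
        rw [htm]
        exact mul_ne_zero pi_ne_zero (sub_ne_zero.2 (by exact_mod_cast hk.symm))
      rw [Real.sinc_of_ne_zero h1, mul_sub, Real.sin_sub, ht, mul_comm π (k : ℝ),
        Real.sin_int_mul_pi]
      simp
  · obtain ⟨B, hB⟩ := exists_norm_le_of_lintegral_le hL hF hθα
    have hsum := (summable_sampling hα hL hF t).hasSum.comp Finset.tendsto_Icc_neg
    have hX : Tendsto (fun N : ℕ => (N + 1 / 2 - |t| : ℝ)) atTop atTop := by
      simpa only [add_sub_assoc] using
        tendsto_atTop_add_const_right atTop (1 / 2 - |t|) tendsto_natCast_atTop_atTop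
    have hlim : Tendsto (fun N : ℕ => C / π + B / (N + 1 / 2 - |t|) * (2 * θ) / π) atTop
        (𝓝 (C / π)) := by
      simpa using (((tendsto_const_nhds.div_atTop hX).mul_const (2 * θ)).div_const π).const_add (C / π)
    have hle := le_of_tendsto_of_tendsto ((hsum.const_sub (F t)).norm) hlim ?_
    -- The two horizontal sides give 2C/(2π) = C/π; the factor 1/π is discarded.
    · refine hle.trans (div_le_self hC0 ?_)
      linarith [pi_gt_three]
    · filter_upwards [hX.eventually_gt_atTop 0] with N hN
      have hN' : |t| < N + 1 / 2 := sub_pos.1 hN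
      have hN0 : (0 : ℝ) < N + 1 / 2 := by positivity
      have h1 := norm_integral_horizontal_le hL0 hL hF (t := t) (y := -θ) hθ hθα hN0 hl
        (by simp [abs_of_pos hθ])
      have h2 := norm_integral_horizontal_le hL0 hL hF (t := t) (y := θ) hθ hθα hN0 hl
        (abs_of_pos hθ)
      have h3 := norm_integral_vertical_le hθ hB hN' (abs_of_pos hN0)
      have h4 := norm_integral_vertical_le hθ hB hN' (X := -(N + 1 / 2)) (by
        rw [abs_neg, abs_of_pos hN0])
      have h5 := congrArg norm (rectIntegral_sampling hF hθ hθα ht hN')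
      rw [norm_mul, norm_mul] at h5
      have h6 : ‖rectIntegral (N + 1 / 2) θ
          (fun z => F z / (Complex.sin (π * z) * (z - t)))‖ ≤
          2 * C + 2 * (B / (N + 1 / 2 - |t|) * (2 * θ)) := by
        rw [rectIntegral]
        refine (norm_sub_le _ _).trans ?_
        refine (add_le_add_left ((norm_add_le _ _).trans
          (add_le_add_left (norm_sub_le _ _) _)) _).trans ?_
        rw [norm_mul, norm_mul, Complex.norm_I, one_mul, one_mul]
        linarith
      have h7 : ‖((Real.sin (π * t) : ℝ) : ℂ)‖ ≤ 1 := by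
        rw [Complex.norm_real]; exact Real.abs_sin_le_one _
      have h8 : ‖(2 * π * Complex.I : ℂ)‖ = 2 * π := by simp [abs_of_pos pi_pos]
      rw [h8] at h5
      have h9 := mul_le_mul h6 h7 (norm_nonneg _) ((norm_nonneg _).trans h6)
      rw [h5] at h9
      rw [← add_div, le_div_iff₀ pi_pos]
      simp only [Function.comp_apply]
      linarith

theorem norm_sub_tsum_sampling_le (hα : 0 < α) (hL0 : 0 ≤ L)
    (hL : ∀ y : ℝ, |y| < α → ∫⁻ s : ℝ, ‖F (s + y * Complex.I)‖ₑ ^ 2 ≤ ENNReal.ofReal L)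
    (hF : DifferentiableOn ℂ F (horizontalStrip α)) {l : ℝ} (hl : 0 < l) (t : ℝ) :
    ‖F t - ∑' k : ℤ, F k * (Real.sinc (π * (t - k)) : ℝ)‖ ≤
      (l * L + l⁻¹ * (π / α)) / (2 * Real.sinh (π * α)) := by
  have hsh : 0 < Real.sinh (π * α) := Real.sinh_pos_iff.2 (by positivity)
  have hc : ContinuousAt (fun θ => (l * L + l⁻¹ * (π / θ)) / (2 * Real.sinh (π * θ))) α := by
    apply ContinuousAt.div
    · exact continuousAt_const.add (continuousAt_const.mul
        (continuousAt_const.div continuousAt_id hα.ne'))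
    · exact (by fun_prop : Continuous fun θ => 2 * Real.sinh (π * θ)).continuousAt
    · positivity
  refine ge_of_tendsto (hc.tendsto.mono_left (nhdsWithin_le_nhds (s := Iio α))) ?_
  filter_upwards [Ioo_mem_nhdsLT hα] with θ hθ
  exact norm_sub_tsum_sampling_le_aux hα hL0 hL hF hθ.1 hθ.2 hl t

end MellinHardy

/-! ### Transfer from the polar strip to the horizontal strip -/

namespace MellinHardy

/-- A function on the polar half-plane transported to a strip through `z ↦ e^{z / T}` and multiplied
by the weight `e^{c z / T}`. -/
noncomputable def logLift (c T : ℝ) (f : ℝ × ℝ → ℂ) (z : ℂ) : ℂ :=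
  f (Real.exp (z.re / T), z.im / T) * Complex.exp (c * z / T)

variable {a c T : ℝ} {f : ℝ × ℝ → ℂ}

/-- Writing q(z) for the polar coordinates of e^{z/T}, the complex difference quotient of f ∘ q is
the polar difference quotient of f times the difference quotient of e^{z/T}; both factors converge.
-/
theorem differentiableOn_logLift (hT : 0 < T) (hf : PolarAnalyticOn f (strip a)) :
    DifferentiableOn ℂ (logLift c T f) (horizontalStrip (a * T)) := by
  intro z₀ hz₀
  apply DifferentiableAt.differentiableWithinAt
  have hd : DifferentiableAt ℂ (fun z : ℂ => Complex.exp (c * z / T)) z₀ := by fun_prop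
  refine DifferentiableAt.mul ?_ hd
  set q : ℂ → ℝ × ℝ := fun z => (Real.exp (z.re / T), z.im / T) with hq
  have hqc : Continuous q := by fun_prop
  have hqi : Function.Injective q := by
    intro z w h
    have h1 := congrArg Prod.fst h
    have h2 := congrArg Prod.snd h
    simp only [hq, Real.exp_eq_exp, div_left_inj' hT.ne'] at h1 h2
    exact Complex.ext h1 h2
  have hqs : ∀ z ∈ horizontalStrip (a * T), q z ∈ strip a := by
    intro z hz
    refine ⟨Real.exp_pos _, ?_⟩
    have hz' : |z.im| < a * T := hz
    rw [mem_Ioo, ← abs_lt, abs_div, abs_of_pos hT]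
    exact (div_lt_iff₀ hT).2 hz'
  have hpp : ∀ z, polarPoint (q z) = Complex.exp (z / T) := by
    intro z
    simp only [hq, polarPoint, Complex.ofReal_exp]
    rw [← Complex.exp_add]
    congr 1
    conv_rhs => rw [← Complex.re_add_im z]
    push_cast; ring
  obtain ⟨l, hl⟩ := hf (q z₀) (hqs z₀ hz₀)
  have hqt : Tendsto q (𝓝[≠] z₀) (𝓝[strip a \ {q z₀}] (q z₀)) := by
    apply tendsto_nhdsWithin_of_tendsto_nhds_of_eventually_within
    · exact hqc.continuousAt.tendsto.mono_left nhdsWithin_le_nhds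
    · filter_upwards [self_mem_nhdsWithin,
        nhdsWithin_le_nhds ((isOpen_horizontalStrip _).mem_nhds hz₀)] with z hz1 hz2
      exact ⟨hqs z hz2, fun h => hz1 (hqi h)⟩
  have hexp : HasDerivAt (fun z : ℂ => Complex.exp (z / T)) (Complex.exp (z₀ / T) * (1 / T)) z₀ :=
    ((hasDerivAt_id' z₀).div_const (T : ℂ)).cexp
  have hne : Complex.exp (z₀ / T) * (1 / T) ≠ 0 :=
    mul_ne_zero (Complex.exp_ne_zero _) (one_div_ne_zero (Complex.ofReal_ne_zero.2 hT.ne'))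
  have hslope := (hl.comp hqt).mul (hasDerivAt_iff_tendsto_slope.1 hexp)
  refine (hasDerivAt_iff_tendsto_slope.2 (hslope.congr' ?_)).differentiableAt
  -- The nonzero derivative makes e^{z/T} ≠ e^{z₀/T} near z₀, so the common factor cancels.
  filter_upwards [hexp.eventually_ne (c := Complex.exp (z₀ / T)) hne] with z hz
  simp only [Function.comp_apply, hpp, slope_def_field]
  exact div_mul_div_cancel₀ (sub_ne_zero.2 hz)

theorem xNorm_sq (φ : ℝ → ℂ) :
    xNorm 2 c φ ^ (2 : ℝ) = ∫⁻ r in Ioi 0, ENNReal.ofReal (r ^ (c - 1 / 2)) ^ 2 * ‖φ r‖ₑ ^ 2 := by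
  rw [xNorm, show ENNReal.ofReal 2 = 2 by simp, eLpNorm_eq_lintegral_rpow_enorm_toReal (by simp) (by simp),
    ← ENNReal.rpow_mul]
  simp only [ENNReal.toReal_ofNat, one_div, ne_eq, OfNat.ofNat_ne_zero, not_false_eq_true,
    inv_mul_cancel₀, ENNReal.rpow_one]
  apply setLIntegral_congr_fun measurableSet_Ioi
  intro r hr
  have h1 : 0 ≤ r ^ (c - 1 / 2) := Real.rpow_nonneg (le_of_lt hr) _
  simp only [weighted]
  rw [ENNReal.rpow_ofNat, enorm_smul, mul_pow, Real.enorm_of_nonneg h1, one_div]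

/-- With r = e^{s/T}, the measure r^{2c-1} dr becomes T⁻¹ e^{2cs/T} ds, and e^{2cs/T} is the squared
modulus of the weight in `logLift`. -/
theorem lintegral_logLift (hT : 0 < T) (y : ℝ) :
    ∫⁻ s : ℝ, ‖logLift c T f (s + y * Complex.I)‖ₑ ^ 2 =
      ENNReal.ofReal T * xNorm 2 c (fun r => f (r, y / T)) ^ (2 : ℝ) := by
  have himg : (fun s : ℝ => Real.exp (s / T)) '' univ = Ioi 0 := by
    ext r
    simp only [image_univ, mem_range, mem_Ioi]
    constructor
    · rintro ⟨s, rfl⟩; exact Real.exp_pos _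
    · intro hr
      exact ⟨Real.log r * T, by rw [mul_div_cancel_right₀ _ hT.ne', Real.exp_log hr]⟩
  have hder : ∀ s ∈ univ, HasDerivWithinAt (fun s : ℝ => Real.exp (s / T))
      (Real.exp (s / T) * (1 / T)) univ s := fun s _ =>
    (((hasDerivAt_id' s).div_const T).exp).hasDerivWithinAt
  have hinj : InjOn (fun s : ℝ => Real.exp (s / T)) univ := by
    intro s _ t _ h
    simpa [div_left_inj' hT.ne'] using h
  rw [xNorm_sq, ← himg, lintegral_image_eq_lintegral_abs_deriv_mul MeasurableSet.univ hder hinj,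
    setLIntegral_univ, ← lintegral_const_mul' _ _ ENNReal.ofReal_ne_top]
  congr 1 with s
  have h1 : ‖Complex.exp (c * (s + y * Complex.I) / T)‖ₑ = ENNReal.ofReal (Real.exp (c * s / T)) := by
    rw [← ofReal_norm, Complex.norm_exp]
    congr 2
    rw [show (c * (s + y * Complex.I) / T : ℂ) = ((c * s / T : ℝ) : ℂ) + ((c * y / T : ℝ) : ℂ) * Complex.I by
      push_cast; ring]
    simp
  rw [logLift, enorm_mul, mul_pow, h1]
  simp only [Complex.add_re, Complex.ofReal_re, Complex.re_ofReal_mul, Complex.I_re, mul_zero,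
    add_zero, Complex.add_im, Complex.ofReal_im, Complex.im_ofReal_mul, Complex.I_im, mul_one, zero_add]
  rw [mul_comm, ← mul_assoc, ← mul_assoc]
  congr 1
  rw [← ENNReal.ofReal_pow (Real.exp_pos _).le,
    ← ENNReal.ofReal_pow (Real.rpow_nonneg (Real.exp_pos _).le _), ← ENNReal.ofReal_mul hT.le,
    ← ENNReal.ofReal_mul (by positivity), abs_of_pos (by positivity), ← Real.exp_mul]
  congr 1
  rw [mul_left_comm, ← mul_assoc, mul_assoc _ T, mul_one_div_cancel hT.ne', mul_one,
    ← Real.exp_nat_mul, ← Real.exp_nat_mul, ← Real.exp_add]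
  congr 1
  field_simp
  push_cast
  ring

/-- The Hardy norm averages over ±θ with θ > 0, so each line costs at most a factor 2; the line θ =
0 is outside the supremum and enters through its own finite norm. -/
theorem exists_xNorm_sq_le (ha : 0 < a) (hf : MemHardy 2 c a f) :
    ∃ M : ℝ, 0 ≤ M ∧ ∀ θ ∈ Ioo (-a) a,
      xNorm 2 c (fun r => f (r, θ)) ^ (2 : ℝ) ≤ ENNReal.ofReal M := by
  set A : ℝ≥0∞ := 2 * hardyNorm 2 c a f ^ (2 : ℝ) + xNorm 2 c (fun r => f (r, 0)) ^ (2 : ℝ)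
  have key : ∀ θ ∈ Ioo (0 : ℝ) a, xNorm 2 c (fun r => f (r, θ)) ^ (2 : ℝ) +
      xNorm 2 c (fun r => f (r, -θ)) ^ (2 : ℝ) ≤ 2 * hardyNorm 2 c a f ^ (2 : ℝ) := by
    intro θ hθ
    have h := le_iSup₂ (f := fun θ (_ : θ ∈ Ioo (0 : ℝ) a) =>
      ((xNorm 2 c (fun r => f (r, θ)) ^ (2 : ℝ) + xNorm 2 c (fun r => f (r, -θ)) ^ (2 : ℝ)) / 2) ^
        (1 / 2 : ℝ)) θ hθ
    have h2 := ENNReal.rpow_le_rpow h (zero_le_two (α := ℝ))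
    rw [← ENNReal.rpow_mul, one_div, inv_mul_cancel₀ two_ne_zero, ENNReal.rpow_one] at h2
    have h3 := ENNReal.div_le_iff (by simp) (by simp) |>.1 h2
    rw [mul_comm]
    simpa [hardyNorm] using h3
  have hA : A ≠ ∞ := by
    exact ENNReal.add_ne_top.2 ⟨ENNReal.mul_ne_top (by simp)
        (ENNReal.rpow_ne_top_of_nonneg zero_le_two hf.norm_lt_top.ne),
        ENNReal.rpow_ne_top_of_nonneg zero_le_two (hf.memX 0 ⟨by linarith, ha⟩).2.ne⟩
  refine ⟨A.toReal, ENNReal.toReal_nonneg, fun θ hθ => ?_⟩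
  rw [ENNReal.ofReal_toReal hA]
  rcases lt_trichotomy θ 0 with h | rfl | h
  · have := key (-θ) ⟨by linarith, by linarith [hθ.1]⟩
    rw [neg_neg] at this
    exact (le_add_self.trans this).trans le_self_add
  · exact le_add_self
  · exact (le_self_add.trans (key θ ⟨h, hθ.2⟩)).trans le_self_add

theorem lintegral_logLift_le (hT : 0 < T) {M : ℝ} (hM : ∀ θ ∈ Ioo (-a) a,
      xNorm 2 c (fun r => f (r, θ)) ^ (2 : ℝ) ≤ ENNReal.ofReal M) (y : ℝ) (hy : |y| < a * T) :
    ∫⁻ s : ℝ, ‖logLift c T f (s + y * Complex.I)‖ₑ ^ 2 ≤ ENNReal.ofReal (T * M) := by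
  rw [lintegral_logLift hT, ENNReal.ofReal_mul hT.le]
  gcongr
  apply hM
  rw [mem_Ioo, ← abs_lt, abs_div, abs_of_pos hT]
  exact (div_lt_iff₀ hT).2 hy

theorem logLift_log (hT : 0 < T) {x : ℝ} (hx : 0 < x) :
    logLift c T f ((T * Real.log x : ℝ) : ℂ) = (x ^ c : ℝ) * f (x, 0) := by
  have hT' : (T : ℂ) ≠ 0 := Complex.ofReal_ne_zero.2 hT.ne'
  rw [logLift, Complex.ofReal_re, Complex.ofReal_im, mul_div_cancel_left₀ _ hT.ne', zero_div,
    Real.exp_log hx, Real.rpow_def_of_pos hx, mul_comm, Complex.ofReal_exp]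
  congr 2
  push_cast
  field_simp

/-- The factor x^c cancels the power of x in `lin`, leaving e^{ck/T}, which is exactly the weight of
`logLift` at k. -/
theorem samplingTerm_eq (hT : 0 < T) {x : ℝ} (hx : 0 < x) (k : ℤ) :
    (x ^ c : ℝ) * samplingTerm c T (fun r => f (r, 0)) x k =
      logLift c T f k * (Real.sinc (π * (T * Real.log x - k)) : ℝ) := by
  have h1 : logLift c T f k = (Real.exp (c * k / T) : ℝ) * f (Real.exp (k / T), 0) := by
    simp [logLift, mul_comm]
  have h2 : Real.log (Real.exp (-k) * x ^ T) = T * Real.log x - k := by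
    rw [Real.log_mul (Real.exp_pos _).ne' (Real.rpow_pos_of_pos hx _).ne', Real.log_exp,
      Real.log_rpow hx]
    ring
  have h3 : x ^ c * (Real.exp (-k) * x ^ T) ^ (-(c / T)) = Real.exp (c * k / T) := by
    rw [Real.rpow_def_of_pos (mul_pos (Real.exp_pos _) (Real.rpow_pos_of_pos hx _)), h2,
      Real.rpow_def_of_pos hx, ← Real.exp_add]
    congr 1
    field_simp
    ring
  rw [samplingTerm, lin, h1, h2, ← h3]
  push_cast
  ring

theorem summable_samplingTerm (ha : 0 < a) (hT : 0 < T) (hf : MemHardy 2 c a f) {x : ℝ} (hx : 0 < x) :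
    Summable (samplingTerm c T (fun r => f (r, 0)) x) := by
  obtain ⟨M, hM0, hM⟩ := exists_xNorm_sq_le ha hf
  have hs := summable_sampling (mul_pos ha hT) (lintegral_logLift_le hT hM)
    (differentiableOn_logLift hT hf.polarAnalytic) (T * Real.log x)
  simp_rw [← samplingTerm_eq hT hx] at hs
  exact (summable_mul_left_iff (Complex.ofReal_ne_zero.2 (Real.rpow_pos_of_pos hx c).ne')).1 hs

/-- The strip estimate is used with α = aT, L = TM and l = 1/T, which makes the numerator M + π/a
independent of T. -/
theorem rpow_mul_norm_remainder_le (ha : 0 < a) (hT : 0 < T) (hf : MemHardy 2 c a f) {M : ℝ}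
    (hM0 : 0 ≤ M) (hM : ∀ θ ∈ Ioo (-a) a,
      xNorm 2 c (fun r => f (r, θ)) ^ (2 : ℝ) ≤ ENNReal.ofReal M) {x : ℝ} (hx : 0 < x) :
    x ^ c * ‖remainder c T (fun r => f (r, 0)) x‖ ≤ (M + π / a) / (2 * Real.sinh (a * π * T)) := by
  have h := norm_sub_tsum_sampling_le (mul_pos ha hT) (mul_nonneg hT.le hM0)
    (lintegral_logLift_le hT hM) (differentiableOn_logLift hT hf.polarAnalytic) (inv_pos.2 hT)
    (T * Real.log x)
  simp_rw [← samplingTerm_eq hT hx] at h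
  rw [logLift_log hT hx, tsum_mul_left, ← mul_sub, norm_mul, Complex.norm_real,
    Real.norm_of_nonneg (Real.rpow_nonneg hx.le c), inv_inv, inv_mul_cancel_left₀ hT.ne',
    show π * (a * T) = a * π * T by ring, show T * (π / (a * T)) = π / a by field_simp] at h
  exact h

theorem memXInf_remainder (ha : 0 < a) (hT : 0 < T) (hf : MemHardy 2 c a f) :
    MemXInf c (remainder c T (fun r => f (r, 0))) := by
  refine ⟨AEStronglyMeasurable.sub ?_ ?_, ?_⟩
  · have h1 := continuous_line (differentiableOn_logLift (c := c) hT hf.polarAnalytic) (y := 0)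
      (by simpa using mul_pos ha hT)
    have h2 : ContinuousOn (fun x : ℝ => ((x ^ (-c) : ℝ) : ℂ) *
        logLift c T f ((T * Real.log x : ℝ) + (0 : ℝ) * Complex.I)) (Ioi 0) := by
      apply ContinuousOn.mul
      · exact Complex.continuous_ofReal.comp_continuousOn
          (continuousOn_id.rpow_const fun x hx => Or.inl (ne_of_gt hx))
      · exact h1.comp_continuousOn (continuousOn_const.mul
          (Real.continuousOn_log.mono fun x hx => ne_of_gt hx))
    refine (h2.aestronglyMeasurable measurableSet_Ioi).congr ?_
    filter_upwards [ae_restrict_mem measurableSet_Ioi] with x hx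
    rw [Complex.ofReal_zero, zero_mul, add_zero, logLift_log hT hx, ← mul_assoc, ← Complex.ofReal_mul,
      ← Real.rpow_add hx, neg_add_cancel, Real.rpow_zero, Complex.ofReal_one, one_mul]
  -- The sum of the series is measurable as a pointwise limit of its symmetric partial sums.
  · apply aestronglyMeasurable_of_tendsto_ae atTop (f := fun (N : ℕ) x =>
      ∑ k ∈ Finset.Icc (-N : ℤ) N, samplingTerm c T (fun r => f (r, 0)) x k)
    · intro N
      apply Measurable.aestronglyMeasurable
      apply Finset.measurable_fun_sum
      intro k _
      have : Measurable (fun x : ℝ => lin (c / T) (Real.exp (-k) * x ^ T)) := by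
        unfold lin
        have := Real.continuous_sinc.measurable
        fun_prop
      exact (Complex.measurable_ofReal.comp this).const_mul _
    · filter_upwards [ae_restrict_mem measurableSet_Ioi] with x hx
      exact (summable_samplingTerm ha hT hf hx).hasSum.comp Finset.tendsto_Icc_neg
  · obtain ⟨M, hM0, hM⟩ := exists_xNorm_sq_le ha hf
    refine ⟨(M + π / a) / (2 * Real.sinh (a * π * T)), ?_⟩
    rintro _ ⟨x, hx, rfl⟩
    exact rpow_mul_norm_remainder_le ha hT hf hM0 hM hx

theorem isBigO_xInfNorm_remainder (ha : 0 < a) (hf : MemHardy 2 c a f) :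
    (fun T : ℝ => xInfNorm c (remainder c T (fun r => f (r, 0))))
      =O[atTop] (fun T : ℝ => Real.exp (-(a * π * T))) := by
  obtain ⟨M, hM0, hM⟩ := exists_xNorm_sq_le ha hf
  -- Once aπT ≥ 1, 2 sinh(aπT) ≥ e^{aπT} - 1 ≥ e^{aπT}/2, whence the factor 2.
  apply IsBigO.of_bound (2 * (M + π / a))
  have hlim : Tendsto (fun T : ℝ => a * π * T) atTop atTop :=
    tendsto_id.const_mul_atTop (by positivity)
  filter_upwards [eventually_gt_atTop 0, hlim.eventually_ge_atTop 1] with T hT hT1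
  have hexp : 2 ≤ Real.exp (a * π * T) := by linarith [Real.add_one_le_exp (a * π * T)]
  have hneg : Real.exp (-(a * π * T)) ≤ 1 := Real.exp_le_one_iff.2 (by linarith)
  have hsinh : Real.exp (a * π * T) / 2 ≤ 2 * Real.sinh (a * π * T) := by
    rw [Real.sinh_eq]; linarith
  have hC : 0 ≤ M + π / a := by positivity
  have h1 : xInfNorm c (remainder c T (fun r => f (r, 0))) ≤
      (M + π / a) / (2 * Real.sinh (a * π * T)) := by
    apply csSup_le (nonempty_Ioi.image _)
    rintro _ ⟨x, hx, rfl⟩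
    exact rpow_mul_norm_remainder_le ha hT hf hM0 hM hx
  have h0 : 0 ≤ xInfNorm c (remainder c T (fun r => f (r, 0))) := by
    apply Real.sSup_nonneg
    rintro _ ⟨x, hx, rfl⟩
    exact mul_nonneg (Real.rpow_nonneg (le_of_lt hx) _) (norm_nonneg _)
  rw [Real.norm_of_nonneg h0, Real.norm_of_nonneg (Real.exp_pos _).le]
  refine h1.trans ((div_le_div_of_nonneg_left hC (by positivity) hsinh).trans (le_of_eq ?_))
  rw [Real.exp_neg]
  field_simp

end MellinHardy

theorem corollary1 (a c : ℝ) (ha : 0 < a) (f : ℝ × ℝ → ℂ) (hf : MellinHardy.MemHardy 2 c a f) :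
    (∀ T : ℝ, 0 < T → ∀ x : ℝ, 0 < x →
      Summable (MellinHardy.samplingTerm c T (fun r => f (r, 0)) x)) ∧
    (∀ T : ℝ, 0 < T →
      MellinHardy.MemXInf c (MellinHardy.remainder c T (fun r => f (r, 0)))) ∧
    (fun T : ℝ => MellinHardy.xInfNorm c (MellinHardy.remainder c T (fun r => f (r, 0))))
      =O[atTop] (fun T : ℝ => Real.exp (-(a * π * T))) :=
  ⟨fun _ hT _ hx => MellinHardy.summable_samplingTerm ha hT hf hx,
    fun _ hT => MellinHardy.memXInf_remainder ha hT hf,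
    MellinHardy.isBigO_xInfNorm_remainder ha hf⟩
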